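/- Let $M$ be a smooth manifold with a connection $D$ on $TM$ (torsion is allowed), let $M'$ be a smooth manifold and let $\iota : M' \to M$ be a totally geodesic embedding, that is, a smooth embedding such that for any two smooth vector fields $X, Y$ on $M$ which are tangent to $M'$ (i.e. $X_{\iota(p)}, Y_{\iota(p)} \in d\iota(T_pM')$ for all $p \in M'$) the covariant derivative $D_XY$ is again tangent to $M'$. (No metric on $M$ is involved, so isotropic submanifolds of pseudo-Riemannian manifolds are included.) Endow $M'$ with the connection $D'$ induced by $D$, i.e. the connection such that $d\iota(D'_XY) = (\iota^*D)_X(d\iota\, Y)$ for all vector fields $X, Y$ on $M'$, where $\iota^*D$ is the pull-back connection on $\iota^*TM$. A map $f : N \to P$ from a pseudo-Riemannian manifold $(N,h)$ to a manifold $P$ with a connection $D^P$ is called harmonic if it is smooth and $$\operatorname{tr} D df = \sum_i \varepsilon_i\, (D_{e_i} df)(e_i) = 0$$ at every point of $N$, where $D$ is the connection on $T^*N \otimes f^*TP$ induced by the Levi-Civita connection of $h$ and by $D^P$, and where $(e_i)$ is an orthonormal basis of the tangent space, with $h(e_i,e_j) = \varepsilon_i\delta_{ij}$, $\varepsilon_i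 = \pm 1$. Then, for every pseudo-Riemannian manifold $(N,h)$, a map $\varphi : N \to M'$ is harmonic (with respect to $h$ and $D'$) if and only if $\iota \circ \varphi : N \to M$ is harmonic (with respect to $h$ and $D$). All manifolds are Hausdorff, finite-dimensional and without boundary. -/

import Mathlib

open Bundle FiberBundle VectorField
open scoped Manifold ContDiff Topology

noncomputable section

/-- A smooth pseudo-Riemannian metric on a manifold `N` without boundary: a smooth field of
symmetric nondegenerate bilinear forms on the tangent spaces, of any signature. -/
structure PseudoRiemannianMetric (E : Type*) [NormedAddCommGroup E] [NormedSpace ℝ E]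
    (N : Type*) [TopologicalSpace N] [ChartedSpace E N] [IsManifold 𝓘(ℝ, E) ∞ N] where
  inner (x : N) : TangentSpace 𝓘(ℝ, E) x →L[ℝ] TangentSpace 𝓘(ℝ, E) x →L[ℝ] ℝ
  symm (x : N) (v w : TangentSpace 𝓘(ℝ, E) x) : inner x v w = inner x w v
  nondegenerate (x : N) (v : TangentSpace 𝓘(ℝ, E) x) (hv : ∀ w, inner x v w = 0) : v = 0
  contMDiff : ContMDiff 𝓘(ℝ, E) (𝓘(ℝ, E).prod 𝓘(ℝ, E →L[ℝ] E →L[ℝ] ℝ)) ∞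
    (fun x ↦ TotalSpace.mk' (E →L[ℝ] E →L[ℝ] ℝ)
      (E := fun x : N ↦ TangentSpace 𝓘(ℝ, E) x →L[ℝ] TangentSpace 𝓘(ℝ, E) x →L[ℝ] ℝ) x (inner x))

namespace PseudoRiemannianMetric

variable {E : Type*} [NormedAddCommGroup E] [NormedSpace ℝ E]
    {N : Type*} [TopologicalSpace N] [ChartedSpace E N] [IsManifold 𝓘(ℝ, E) ∞ N]
    (h : PseudoRiemannianMetric E N)

theorem mdifferentiableAt_inner {X Y : Π x : N, TangentSpace 𝓘(ℝ, E) x} {x : N}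
    (hX : MDiffAt (T% X) x) (hY : MDiffAt (T% Y) x) :
    MDiffAt (fun y ↦ h.inner y (X y) (Y y)) x := by
  have : MDifferentiableAt 𝓘(ℝ, E) (𝓘(ℝ, E).prod 𝓘(ℝ))
      (fun m ↦ TotalSpace.mk' ℝ (E := Bundle.Trivial N ℝ) m (h.inner m (X m) (Y m))) x := by
    apply MDifferentiableAt.clm_bundle_apply₂ (F₁ := E) (F₂ := E)
    · exact h.contMDiff.mdifferentiableAt (by simp)
    · exact hX
    · exact hY
  simp only [mdifferentiableAt_totalSpace] at this
  exact this.2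

/-- The right-hand side of the Koszul formula
`2 h(∇_X Y, Z) = X h(Y, Z) + Y h(X, Z) - Z h(X, Y) + h([X, Y], Z) - h([X, Z], Y) - h([Y, Z], X)`,
divided by two. -/
def koszul (X Y Z : Π x : N, TangentSpace 𝓘(ℝ, E) x) (x : N) : ℝ :=
  (1 / 2 : ℝ) * (d% (fun y ↦ h.inner y (Y y) (Z y)) x (X x)
    + d% (fun y ↦ h.inner y (X y) (Z y)) x (Y x)
    - d% (fun y ↦ h.inner y (X y) (Y y)) x (Z x)
    + h.inner x (mlieBracket 𝓘(ℝ, E) X Y x) (Z x)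
    - h.inner x (mlieBracket 𝓘(ℝ, E) X Z x) (Y x)
    - h.inner x (mlieBracket 𝓘(ℝ, E) Y Z x) (X x))

variable [FiniteDimensional ℝ E]

theorem koszul_tensorial_left {Y Z : Π x : N, TangentSpace 𝓘(ℝ, E) x} {x : N}
    (hY : MDiffAt (T% Y) x) (hZ : MDiffAt (T% Z) x) :
    TensorialAt 𝓘(ℝ, E) E (fun X ↦ h.koszul X Y Z x) x where
  smul {f X} hf hX := by
    have : CompleteSpace E := FiniteDimensional.complete ℝ E
    have e1 := mvfderiv_fun_mul hf (h.mdifferentiableAt_inner hX hZ)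
    have e2 := mvfderiv_fun_mul hf (h.mdifferentiableAt_inner hX hY)
    simp [koszul, mlieBracket_smul_left hf hX, e1, e2]
    ring
  add {X X'} hX hX' := by
    have : CompleteSpace E := FiniteDimensional.complete ℝ E
    have e1 := mvfderiv_fun_add (h.mdifferentiableAt_inner hX hZ) (h.mdifferentiableAt_inner hX' hZ)
    have e2 := mvfderiv_fun_add (h.mdifferentiableAt_inner hX hY) (h.mdifferentiableAt_inner hX' hY)
    simp [koszul, mlieBracket_add_left hX hX', e1, e2]
    ring

theorem koszul_tensorial_right {X Y : Π x : N, TangentSpace 𝓘(ℝ, E) x} {x : N}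
    (hX : MDiffAt (T% X) x) (hY : MDiffAt (T% Y) x) :
    TensorialAt 𝓘(ℝ, E) E (fun Z ↦ h.koszul X Y Z x) x where
  smul {f Z} hf hZ := by
    have : CompleteSpace E := FiniteDimensional.complete ℝ E
    have e1 := mvfderiv_fun_mul hf (h.mdifferentiableAt_inner hX hZ)
    have e2 := mvfderiv_fun_mul hf (h.mdifferentiableAt_inner hY hZ)
    simp [koszul, mlieBracket_smul_right hf hZ, e1, e2]
    rw [h.symm x (Z x) (X x), h.symm x (Z x) (Y x)]
    ring
  add {Z Z'} hZ hZ' := by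
    have : CompleteSpace E := FiniteDimensional.complete ℝ E
    have e1 := mvfderiv_fun_add (h.mdifferentiableAt_inner hX hZ) (h.mdifferentiableAt_inner hX hZ')
    have e2 := mvfderiv_fun_add (h.mdifferentiableAt_inner hY hZ) (h.mdifferentiableAt_inner hY hZ')
    simp [koszul, mlieBracket_add_right hZ hZ', e1, e2]
    ring


/-- The musical isomorphism `v ↦ h(v, ·)`. -/
def flat (x : N) : TangentSpace 𝓘(ℝ, E) x ≃L[ℝ] (TangentSpace 𝓘(ℝ, E) x →L[ℝ] ℝ) :=
  let B : E →L[ℝ] (E →L[ℝ] ℝ) := h.inner x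
  have hB : Function.Injective B.toLinearMap := by
    refine (injective_iff_map_eq_zero _).2 fun v hv ↦ h.nondegenerate x v fun w ↦ ?_
    exact congrArg (fun φ : E →L[ℝ] ℝ ↦ φ w) hv
  have hr : Module.finrank ℝ E = Module.finrank ℝ (E →L[ℝ] ℝ) := by
    rw [← (LinearMap.toContinuousLinearMap (𝕜 := ℝ) (E := E) (F' := ℝ)).finrank_eq]
    exact (Subspace.dual_finrank_eq (K := ℝ) (V := E)).symm
  (LinearMap.linearEquivOfInjective B.toLinearMap hB hr).toContinuousLinearEquiv

theorem flat_apply (x : N) (v w : TangentSpace 𝓘(ℝ, E) x) : h.flat x v w = h.inner x v w := rfl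

open Classical in
/-- The bilinear form `(X, Z) ↦ h(∇_X Y, Z)` on the tangent space at `x` given by the Koszul
formula (the value at fields `Y` that are not differentiable at `x` is irrelevant). -/
def koszulForm (Y : Π x : N, TangentSpace 𝓘(ℝ, E) x) (x : N) :
    TangentSpace 𝓘(ℝ, E) x →L[ℝ] TangentSpace 𝓘(ℝ, E) x →L[ℝ] ℝ :=
  if hY : MDiffAt (T% Y) x then
    TensorialAt.mkHom₂ (I := 𝓘(ℝ, E)) (F := E) (F' := E) (fun X Z ↦ h.koszul X Y Z x) x
      (fun _ hZ ↦ h.koszul_tensorial_left hY hZ) (fun _ hX ↦ h.koszul_tensorial_right hX hY)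
  else 0

theorem koszulForm_apply {X Y Z : Π x : N, TangentSpace 𝓘(ℝ, E) x} {x : N}
    (hX : MDiffAt (T% X) x) (hY : MDiffAt (T% Y) x) (hZ : MDiffAt (T% Z) x) :
    h.koszulForm Y x (X x) (Z x) = h.koszul X Y Z x := by
  rw [koszulForm, dif_pos hY]
  exact TensorialAt.mkHom₂_apply _ _ hX hZ

theorem koszul_add_middle {X Y Y' Z : Π x : N, TangentSpace 𝓘(ℝ, E) x} {x : N}
    (hX : MDiffAt (T% X) x) (hY : MDiffAt (T% Y) x) (hY' : MDiffAt (T% Y') x)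
    (hZ : MDiffAt (T% Z) x) :
    h.koszul X (Y + Y') Z x = h.koszul X Y Z x + h.koszul X Y' Z x := by
  have : CompleteSpace E := FiniteDimensional.complete ℝ E
  have e1 := mvfderiv_fun_add (h.mdifferentiableAt_inner hX hY) (h.mdifferentiableAt_inner hX hY')
  have e2 := mvfderiv_fun_add (h.mdifferentiableAt_inner hY hZ) (h.mdifferentiableAt_inner hY' hZ)
  simp [koszul, mlieBracket_add_right hY hY', mlieBracket_add_left hY hY', e1, e2]
  ring

theorem koszul_smul_middle {X Y Z : Π x : N, TangentSpace 𝓘(ℝ, E) x} {g : N → ℝ} {x : N}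
    (hX : MDiffAt (T% X) x) (hY : MDiffAt (T% Y) x) (hZ : MDiffAt (T% Z) x) (hg : MDiffAt g x) :
    h.koszul X (g • Y) Z x = g x * h.koszul X Y Z x + d% g x (X x) * h.inner x (Y x) (Z x) := by
  have : CompleteSpace E := FiniteDimensional.complete ℝ E
  have e1 := mvfderiv_fun_mul hg (h.mdifferentiableAt_inner hX hY)
  have e2 := mvfderiv_fun_mul hg (h.mdifferentiableAt_inner hY hZ)
  simp [koszul, mlieBracket_smul_right hg hY, mlieBracket_smul_left hg hY, e1, e2]
  rw [h.symm x (Y x) (X x)]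
  ring

/-- The Levi-Civita connection of `h`: the vector `∇_X Y` is the one for which `h(∇_X Y, ·)` is
given by the Koszul formula. It is metric and torsion-free, see `leviCivita_metric` and
`leviCivita_torsion`. -/
def leviCivita : CovariantDerivative 𝓘(ℝ, E) E (TangentSpace 𝓘(ℝ, E) : N → Type _) where
  toFun Y x := (h.flat x).symm.toContinuousLinearMap ∘L h.koszulForm Y x
  isCovariantDerivativeOnUniv :=
    { add := by
        intro Y Y' x hY hY' _
        have key : h.koszulForm (Y + Y') x = h.koszulForm Y x + h.koszulForm Y' x := by
          ext v w
          have hv := mdifferentiableAt_extend 𝓘(ℝ, E) E v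
          have hw := mdifferentiableAt_extend 𝓘(ℝ, E) E w
          have e0 := h.koszulForm_apply hv (mdifferentiableAt_add_section hY hY') hw
          have e1 := h.koszulForm_apply hv hY hw
          have e2 := h.koszulForm_apply hv hY' hw
          have e3 := h.koszul_add_middle hv hY hY' hw
          simp only [extend_apply_self] at e0 e1 e2
          simp [e0, e1, e2, e3]
        rw [key]
        ext v
        simp
      leibniz := by
        intro Y g x hY hg _
        have key (v w : TangentSpace 𝓘(ℝ, E) x) : h.koszulForm (g • Y) x v w =
            g x * h.koszulForm Y x v w + d% g x v * h.inner x (Y x) w := by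
          have hv := mdifferentiableAt_extend 𝓘(ℝ, E) E v
          have hw := mdifferentiableAt_extend 𝓘(ℝ, E) E w
          have e0 := h.koszulForm_apply hv (hg.smul_section hY) hw
          have e1 := h.koszulForm_apply hv hY hw
          have e3 := h.koszul_smul_middle hv hY hw hg
          simp only [extend_apply_self] at e0 e1 e3
          rw [e0, e1, e3]
        ext v
        apply (h.flat x).injective
        ext w
        simp [key, flat_apply] }

theorem inner_leviCivita {X Y Z : Π x : N, TangentSpace 𝓘(ℝ, E) x} {x : N}
    (hX : MDiffAt (T% X) x) (hY : MDiffAt (T% Y) x) (hZ : MDiffAt (T% Z) x) :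
    h.inner x (h.leviCivita Y x (X x)) (Z x) = h.koszul X Y Z x := by
  rw [← flat_apply, ← h.koszulForm_apply hX hY hZ]
  simp [leviCivita]

theorem leviCivita_metric {X Y Z : Π x : N, TangentSpace 𝓘(ℝ, E) x} {x : N}
    (hX : MDiffAt (T% X) x) (hY : MDiffAt (T% Y) x) (hZ : MDiffAt (T% Z) x) :
    d% (fun y ↦ h.inner y (Y y) (Z y)) x (X x) =
      h.inner x (h.leviCivita Y x (X x)) (Z x) + h.inner x (Y x) (h.leviCivita Z x (X x)) := by
  rw [h.symm x (Y x), h.inner_leviCivita hX hY hZ, h.inner_leviCivita hX hZ hY]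
  simp only [koszul, h.symm _ (Z _) (Y _)]
  rw [mlieBracket_swap_apply (V := Z) (W := Y)]
  simp
  ring

theorem leviCivita_torsion : h.leviCivita.torsion = 0 := by
  have : CompleteSpace E := FiniteDimensional.complete ℝ E
  rw [CovariantDerivative.torsion_eq_zero_iff]
  intro X Y x hX hY
  apply (h.flat x).injective
  ext w
  have hw := mdifferentiableAt_extend 𝓘(ℝ, E) E w
  have e1 := h.inner_leviCivita hX hY hw
  have e2 := h.inner_leviCivita hY hX hw
  simp only [extend_apply_self] at e1 e2
  simp [flat_apply, e1, e2, koszul, h.symm _ (Y _) (X _)]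
  rw [mlieBracket_swap_apply (V := Y) (W := X)]
  simp
  ring

end PseudoRiemannianMetric

section Pullback

variable {E₁ : Type*} [NormedAddCommGroup E₁] [NormedSpace ℝ E₁]
  {N : Type*} [TopologicalSpace N] [ChartedSpace E₁ N]
  {E₂ : Type*} [NormedAddCommGroup E₂] [NormedSpace ℝ E₂]
  {M : Type*} [TopologicalSpace M] [ChartedSpace E₂ M] [IsManifold 𝓘(ℝ, E₂) ∞ M]

/-- The representation of a vector field `s` along `f` in the trivialization of `TM` around `f x`,
as a function of `y` near `x`. -/
def fibreCoord (f : N → M) (s : Π x : N, TangentSpace 𝓘(ℝ, E₂) (f x)) (x y : N) : E₂ :=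
  (trivializationAt E₂ (TangentSpace 𝓘(ℝ, E₂) : M → Type _) (f x)).linearMapAt ℝ (f y) (s y)

/-- The pull-back connection `f^*D` on `f^*TM`, applied to a section `s` of `f^*TM` (a vector
field along `f`). In a local frame `(e_a)` of `TM` around `f x`, with `s = ∑ s^a (e_a ∘ f)`, it is
`(f^*D)_v s = ∑ (v s^a) e_a + ∑ s^a D_{df v} e_a`; here the frame is the constant one of the
trivialization of `TM` at `f x`, and `extend E₂ (s x)` is the field `∑ s^a(x) e_a` around `f x`.
This is the unique additive operation satisfying the Leibniz rule and
`(f^*D)_v (σ ∘ f) = D_{df v} σ`, see `pullbackCov_add`, `pullbackCov_leibniz`,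
`pullbackCov_comp`. -/
def pullbackCov (D : CovariantDerivative 𝓘(ℝ, E₂) E₂ (TangentSpace 𝓘(ℝ, E₂) : M → Type _))
    (f : N → M) (s : Π x : N, TangentSpace 𝓘(ℝ, E₂) (f x)) (x : N) :
    TangentSpace 𝓘(ℝ, E₁) x →L[ℝ] TangentSpace 𝓘(ℝ, E₂) (f x) :=
  (trivializationAt E₂ (TangentSpace 𝓘(ℝ, E₂) : M → Type _) (f x)).symmL ℝ (f x) ∘L
      d% (fibreCoord f s x) x
    + D (extend E₂ (s x)) (f x) ∘L mfderiv 𝓘(ℝ, E₁) 𝓘(ℝ, E₂) f x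

variable (E₁) in
/-- The vector field `s` along `f` is differentiable at `x`. -/
def MDiffAlongAt (f : N → M) (s : Π x : N, TangentSpace 𝓘(ℝ, E₂) (f x)) (x : N) : Prop :=
  MDifferentiableAt 𝓘(ℝ, E₁) (𝓘(ℝ, E₂).prod 𝓘(ℝ, E₂))
    (fun y ↦ (TotalSpace.mk' E₂ (f y) (s y) : TotalSpace E₂ (TangentSpace 𝓘(ℝ, E₂) : M → Type _))) x

variable (D : CovariantDerivative 𝓘(ℝ, E₂) E₂ (TangentSpace 𝓘(ℝ, E₂) : M → Type _)) {f : N → M}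

theorem fibreCoord_eventuallyEq (s : Π x : N, TangentSpace 𝓘(ℝ, E₂) (f x)) {x : N}
    (hf : ContinuousAt f x) : 
    fibreCoord f s x =ᶠ[𝓝 x] fun y ↦ (trivializationAt E₂ (TangentSpace 𝓘(ℝ, E₂) : M → Type _) (f x)
      (TotalSpace.mk' E₂ (f y) (s y))).2 := by
  set e := trivializationAt E₂ (TangentSpace 𝓘(ℝ, E₂) : M → Type _) (f x) with he
  have : e.baseSet ∈ 𝓝 (f x) := e.open_baseSet.mem_nhds (mem_baseSet_trivializationAt' _)
  filter_upwards [hf this] with y hy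
  exact congrFun (e.coe_linearMapAt_of_mem (R := ℝ) hy) (s y)

theorem mdifferentiableAt_fibreCoord {s : Π x : N, TangentSpace 𝓘(ℝ, E₂) (f x)} {x : N}
    (hs : MDiffAlongAt E₁ f s x) : MDifferentiableAt 𝓘(ℝ, E₁) 𝓘(ℝ, E₂) (fibreCoord f s x) x := by
  obtain ⟨h1, h2⟩ := (mdifferentiableAt_totalSpace _ _).1 hs
  exact h2.congr_of_eventuallyEq (fibreCoord_eventuallyEq s h1.continuousAt)

theorem extend_eventuallyEq (y : M) (v : TangentSpace 𝓘(ℝ, E₂) y) :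
    ∀ᶠ z in 𝓝 y, extend E₂ v z =
      (trivializationAt E₂ (TangentSpace 𝓘(ℝ, E₂) : M → Type _) y).symmₗ ℝ z
        ((trivializationAt E₂ (TangentSpace 𝓘(ℝ, E₂) : M → Type _) y).linearMapAt ℝ y v) := by
  set e := trivializationAt E₂ (TangentSpace 𝓘(ℝ, E₂) : M → Type _) y with he
  have hy : y ∈ e.baseSet := mem_baseSet_trivializationAt' _
  filter_upwards [e.open_baseSet.mem_nhds hy] with z hz
  rw [e.symmₗ_apply hz, e.coe_linearMapAt_of_mem hy]
  rfl

theorem cov_extend_linear (y : M) (a : ℝ) (v w : TangentSpace 𝓘(ℝ, E₂) y) :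
    D (extend E₂ (a • v + w)) y = a • D (extend E₂ v) y + D (extend E₂ w) y := by
  have h1 := mdifferentiableAt_extend 𝓘(ℝ, E₂) E₂ v
  have h2 := mdifferentiableAt_extend 𝓘(ℝ, E₂) E₂ w
  have h3 : MDiffAt (T% (a • extend E₂ v)) y := mdifferentiableAt_const.smul_section h1
  rw [← D.isCovariantDerivativeOn.smul_const (s := Set.univ) a h1,
    ← D.isCovariantDerivativeOn.add (s := Set.univ) h3 h2]
  refine D.isCovariantDerivativeOnUniv.congr_of_eventuallyEq (mdifferentiableAt_extend ..)
    (mdifferentiableAt_add_section h3 h2) Filter.univ_mem ?_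
  filter_upwards [extend_eventuallyEq y (a • v + w), extend_eventuallyEq y v,
    extend_eventuallyEq y w] with z e1 e2 e3
  simp [e1, e2, e3]

theorem cov_extend_smul (y : M) (a : ℝ) (v : TangentSpace 𝓘(ℝ, E₂) y) :
    D (extend E₂ (a • v)) y = a • D (extend E₂ v) y := by
  have h0 := cov_extend_linear D y 1 (0 : TangentSpace 𝓘(ℝ, E₂) y) 0
  have h1 := cov_extend_linear D y a v 0
  simp only [one_smul, add_zero, left_eq_add] at h0 h1
  rw [h1, h0, add_zero]

theorem symmL_fibreCoord (s : Π x : N, TangentSpace 𝓘(ℝ, E₂) (f x)) (x : N) :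
    (trivializationAt E₂ (TangentSpace 𝓘(ℝ, E₂) : M → Type _) (f x)).symmL ℝ (f x) (fibreCoord f s x x) = s x :=
  (trivializationAt E₂ (TangentSpace 𝓘(ℝ, E₂) : M → Type _) (f x)).symmL_continuousLinearMapAt
    (mem_baseSet_trivializationAt' _) (s x)

theorem pullbackCov_add {s t : Π x : N, TangentSpace 𝓘(ℝ, E₂) (f x)} {x : N}
    (hs : MDiffAlongAt E₁ f s x) (ht : MDiffAlongAt E₁ f t x) :
    pullbackCov (E₁ := E₁) D f (s + t) x = pullbackCov D f s x + pullbackCov D f t x := by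
  have h1 : fibreCoord f (s + t) x = fun y ↦ fibreCoord f s x y + fibreCoord f t x y := by
    ext y; simp [fibreCoord]
  have h2 := cov_extend_linear D (f x) 1 (s x) (t x)
  have h3 := mvfderiv_fun_add (mdifferentiableAt_fibreCoord hs) (mdifferentiableAt_fibreCoord ht)
  ext v
  simp only [one_smul] at h2
  simp [pullbackCov, h1, h2, h3]
  abel

theorem pullbackCov_leibniz {s : Π x : N, TangentSpace 𝓘(ℝ, E₂) (f x)} {g : N → ℝ} {x : N}
    (hs : MDiffAlongAt E₁ f s x) (hg : MDifferentiableAt 𝓘(ℝ, E₁) 𝓘(ℝ, ℝ) g x) :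
    pullbackCov (E₁ := E₁) D f (fun y ↦ g y • s y) x =
      g x • pullbackCov D f s x + (d% g x).smulRight (s x) := by
  have h1 : fibreCoord f (fun y ↦ g y • s y) x = g • fibreCoord f s x := by
    ext y; simp [fibreCoord]
  have h2 := cov_extend_smul D (f x) (g x) (s x)
  have h3 := mvfderiv_smul hg (mdifferentiableAt_fibreCoord hs)
  have h4 := symmL_fibreCoord s x
  ext v
  simp [pullbackCov, h1, h2, h3, h4]
  abel

theorem cov_eq_pullbackCov_id [FiniteDimensional ℝ E₂] {σ : Π y : M, TangentSpace 𝓘(ℝ, E₂) y} {y : M}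
    (hσ : MDiffAt (T% σ) y) : D σ y = pullbackCov D (fun z : M ↦ z) σ y := by
  have hT : TensorialAt 𝓘(ℝ, E₂) E₂
      (fun σ : Π z : M, TangentSpace 𝓘(ℝ, E₂) z ↦ D σ y - pullbackCov D (fun z : M ↦ z) σ y) y :=
    { smul := by
        intro g σ hg hσ
        have h1 := pullbackCov_leibniz (f := fun z : M ↦ z) D hσ hg
        have h2 := D.isCovariantDerivativeOnUniv.leibniz hσ hg
        have h3 : pullbackCov D (fun z : M ↦ z) (g • σ) y = _ := h1
        rw [h2, h3]
        module
      add := by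
        intro σ σ' hσ hσ'
        have h1 := pullbackCov_add (f := fun z : M ↦ z) D hσ hσ'
        have h2 := D.isCovariantDerivativeOnUniv.add hσ hσ'
        rw [h1, h2]
        module }
  have h1 := hT.pointwise hσ (mdifferentiableAt_extend 𝓘(ℝ, E₂) E₂ (σ y)) (by simp)
  rw [← sub_eq_zero, h1, sub_eq_zero]
  have h2 : fibreCoord (fun z : M ↦ z) (extend E₂ (σ y)) y =ᶠ[𝓝 y]
      fun _ ↦ (trivializationAt E₂ (TangentSpace 𝓘(ℝ, E₂) : M → Type _) y).linearMapAt ℝ y (σ y) := by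
    set e := trivializationAt E₂ (TangentSpace 𝓘(ℝ, E₂) : M → Type _) y with he
    have hy : y ∈ e.baseSet := mem_baseSet_trivializationAt' _
    filter_upwards [extend_eventuallyEq y (σ y), e.open_baseSet.mem_nhds hy] with z e1 hz
    rw [fibreCoord, e1]
    exact e.linearMapAt_symmₗ hz _
  have h3 : mvfderiv 𝓘(ℝ, E₂) (fibreCoord (fun z : M ↦ z) (extend E₂ (σ y)) y) y = 0 := by
    rw [mvfderiv, h2.mfderiv_eq, mfderiv_const]
    exact ContinuousLinearMap.comp_zero _
  have h4 : mfderiv 𝓘(ℝ, E₂) 𝓘(ℝ, E₂) (fun z : M ↦ z) y = ContinuousLinearMap.id ℝ _ := mfderiv_id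
  rw [pullbackCov, h3, h4]
  ext v
  simp

theorem pullbackCov_comp [FiniteDimensional ℝ E₂] {σ : Π y : M, TangentSpace 𝓘(ℝ, E₂) y} {x : N}
    (hf : MDifferentiableAt 𝓘(ℝ, E₁) 𝓘(ℝ, E₂) f x) (hσ : MDiffAt (T% σ) (f x)) :
    pullbackCov D f (fun x ↦ σ (f x)) x = D σ (f x) ∘L mfderiv 𝓘(ℝ, E₁) 𝓘(ℝ, E₂) f x := by
  have hd := mfderiv_comp x
    (mdifferentiableAt_fibreCoord (E₁ := E₂) (f := fun z : M ↦ z) (s := σ) (x := f x) hσ) hf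
  have hc : mvfderiv 𝓘(ℝ, E₁) (fibreCoord f (fun x ↦ σ (f x)) x) x =
      mvfderiv 𝓘(ℝ, E₂) (fibreCoord (fun z : M ↦ z) σ (f x)) (f x) ∘L
        mfderiv 𝓘(ℝ, E₁) 𝓘(ℝ, E₂) f x := by
    ext v
    exact congrArg (fun L ↦ L v) hd
  have h4 : mfderiv 𝓘(ℝ, E₂) 𝓘(ℝ, E₂) (fun z : M ↦ z) (f x) = ContinuousLinearMap.id ℝ _ :=
    mfderiv_id
  rw [cov_eq_pullbackCov_id D hσ, pullbackCov, pullbackCov, hc, h4]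
  ext v
  simp

theorem mfderiv_injective_of_isImmersion [IsManifold 𝓘(ℝ, E₁) ∞ N]
    (hf : Manifold.IsImmersion 𝓘(ℝ, E₁) 𝓘(ℝ, E₂) ∞ f) (x : N) :
    Function.Injective (mfderiv 𝓘(ℝ, E₁) 𝓘(ℝ, E₂) f x) := by
  have H := hf.isImmersionAt x
  have hx := H.mem_domChart_source
  have hfx := H.mem_codChart_source
  have hd : MDifferentiableAt 𝓘(ℝ, E₁) 𝓘(ℝ, E₂) f x := H.contMDiffAt.mdifferentiableAt (by simp)
  let pr : E₂ →L[ℝ] E₁ := ContinuousLinearMap.fst ℝ E₁ _ ∘L H.equiv.symm.toContinuousLinearMap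
  have hpr (u : E₁) : pr (H.equiv (u, 0)) = u := by simp [pr]
  have e1 : ∀ z ∈ H.domChart.source, pr (H.codChart (f z)) = H.domChart z := by
    intro z hz
    have hz' : H.domChart z ∈ (H.domChart.extend 𝓘(ℝ, E₁)).target := by simp [hz]
    have := H.writtenInCharts hz'
    simp [hz] at this
    rw [this, hpr]
  have hc : MDifferentiableAt 𝓘(ℝ, E₂) 𝓘(ℝ, E₂) H.codChart (f x) :=
    (contMDiffAt_of_mem_maximalAtlas H.codChart_mem_maximalAtlas hfx).mdifferentiableAt (by simp)
  have hs : MDifferentiableAt 𝓘(ℝ, E₁) 𝓘(ℝ, E₁) H.domChart.symm (pr (H.codChart (f x))) := by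
    rw [e1 x hx]
    exact (contMDiffAt_symm_of_mem_maximalAtlas H.domChart_mem_maximalAtlas
      (H.domChart.map_source hx)).mdifferentiableAt (by simp)
  have hg : MDifferentiableAt 𝓘(ℝ, E₂) 𝓘(ℝ, E₁) (H.domChart.symm ∘ pr ∘ H.codChart) (f x) :=
    MDifferentiableAt.comp (f x) (g := H.domChart.symm) (f := pr ∘ H.codChart) hs
      (MDifferentiableAt.comp (f x) (g := pr) pr.mdifferentiableAt hc)
  have hcomp := mfderiv_comp x hg hd
  have hid : (H.domChart.symm ∘ pr ∘ H.codChart) ∘ f =ᶠ[𝓝 x] id := by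
    filter_upwards [H.domChart.open_source.mem_nhds hx] with z hz
    simp [e1 z hz, hz]
  intro v w hvw
  have h1 := congrArg (mfderiv 𝓘(ℝ, E₂) 𝓘(ℝ, E₁) (H.domChart.symm ∘ pr ∘ H.codChart) (f x)) hvw
  have h2 (u : TangentSpace 𝓘(ℝ, E₁) x) : mfderiv 𝓘(ℝ, E₂) 𝓘(ℝ, E₁)
      (H.domChart.symm ∘ pr ∘ H.codChart) (f x) (mfderiv 𝓘(ℝ, E₁) 𝓘(ℝ, E₂) f x u) = u := by
    have := congrArg (fun L ↦ L u) (hcomp.symm.trans (hid.mfderiv_eq.trans mfderiv_id))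
    exact this
  rwa [h2, h2] at h1

end Pullback

section Harmonic

variable {E' : Type*} [NormedAddCommGroup E'] [NormedSpace ℝ E']
  {M' : Type*} [TopologicalSpace M'] [ChartedSpace E' M'] [IsManifold 𝓘(ℝ, E') ∞ M']
  {E : Type*} [NormedAddCommGroup E] [NormedSpace ℝ E]
  {M : Type*} [TopologicalSpace M] [ChartedSpace E M] [IsManifold 𝓘(ℝ, E) ∞ M]

variable (E') in
/-- The vector field `X` on `M` is tangent to the immersed submanifold `ι : M' → M`, that is
`X (ι p) ∈ dι (T_p M')` for all points `p` of `M'`. -/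
def IsTangentTo (ι : M' → M) (X : Π y : M, TangentSpace 𝓘(ℝ, E) y) : Prop :=
  ∀ p : M', X (ι p) ∈ (mfderiv 𝓘(ℝ, E') 𝓘(ℝ, E) ι p).range

variable (E') in
/-- `ι` is a smooth embedding, and `D_X Y` is tangent to `M'` whenever the smooth vector fields
`X`, `Y` on `M` are tangent to `M'`. No metric on `M` enters. -/
structure IsTotallyGeodesicEmbedding
    (D : CovariantDerivative 𝓘(ℝ, E) E (TangentSpace 𝓘(ℝ, E) : M → Type _)) (ι : M' → M) :
    Prop where
  isSmoothEmbedding : Manifold.IsSmoothEmbedding 𝓘(ℝ, E') 𝓘(ℝ, E) ∞ ι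
  tangent : ∀ X Y : Π y : M, TangentSpace 𝓘(ℝ, E) y, CMDiff ∞ (T% X) → CMDiff ∞ (T% Y) →
    IsTangentTo E' ι X → IsTangentTo E' ι Y →
    IsTangentTo E' ι (fun y ↦ D Y y (X y))

theorem exists_leftInverse [FiniteDimensional ℝ E] {ι : M' → M}
    (hι : Manifold.IsSmoothEmbedding 𝓘(ℝ, E') 𝓘(ℝ, E) ∞ ι) (p : M') :
    ∃ L : TangentSpace 𝓘(ℝ, E) (ι p) →L[ℝ] TangentSpace 𝓘(ℝ, E') p,
      ∀ v, L (mfderiv 𝓘(ℝ, E') 𝓘(ℝ, E) ι p v) = v := by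
  let A : E' →L[ℝ] E := mfderiv 𝓘(ℝ, E') 𝓘(ℝ, E) ι p
  have hA : Function.Injective A := mfderiv_injective_of_isImmersion hι.isImmersion p
  obtain ⟨L, hL⟩ : ∃ L : E →ₗ[ℝ] E', L ∘ₗ (A : E' →ₗ[ℝ] E) = LinearMap.id :=
    LinearMap.exists_leftInverse_of_injective _ (LinearMap.ker_eq_bot.2 hA)
  let L' : E →L[ℝ] E' := LinearMap.toContinuousLinearMap L
  exact ⟨L', fun v ↦ congrArg (fun T : E' →ₗ[ℝ] E' ↦ T v) hL⟩

theorem mdiffAlongAt_pushforward {ι : M' → M} (hι : ContMDiff 𝓘(ℝ, E') 𝓘(ℝ, E) ∞ ι)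
    {Y : Π p : M', TangentSpace 𝓘(ℝ, E') p} {p : M'} (hY : MDiffAt (T% Y) p) :
    MDiffAlongAt E' ι (fun q ↦ mfderiv 𝓘(ℝ, E') 𝓘(ℝ, E) ι q (Y q)) p := by
  have h1 := (hι.contMDiff_tangentMap (m := 1) (by norm_cast)).mdifferentiable (by simp)
  exact MDifferentiableAt.comp p (h1 _) hY

/-- The connection `D'` induced by `D` on a totally geodesic submanifold, the one with `D dι = 0`:
`dι (D'_X Y) = (ι^*D)_X (dι Y)`, i.e. `D'_X Y` is `D_X Y` for any tangent extensions of `X`, `Y`.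
The right-hand side lies in the range of the injective map `dι` since `ι` is totally geodesic,
so it may be solved for `D'_X Y` with any linear left inverse of `dι`. -/
def inducedConnection [FiniteDimensional ℝ E]
    (D : CovariantDerivative 𝓘(ℝ, E) E (TangentSpace 𝓘(ℝ, E) : M → Type _)) (ι : M' → M)
    (hι : IsTotallyGeodesicEmbedding E' D ι) :
    CovariantDerivative 𝓘(ℝ, E') E' (TangentSpace 𝓘(ℝ, E') : M' → Type _) where
  toFun Y p := (exists_leftInverse hι.isSmoothEmbedding p).choose ∘L
    pullbackCov D ι (fun q ↦ mfderiv 𝓘(ℝ, E') 𝓘(ℝ, E) ι q (Y q)) p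
  isCovariantDerivativeOnUniv :=
    { add := by
        intro Y Y' p hY hY' _
        have h1 := pullbackCov_add D (mdiffAlongAt_pushforward hι.isSmoothEmbedding.contMDiff hY)
          (mdiffAlongAt_pushforward hι.isSmoothEmbedding.contMDiff hY')
        have h2 : (fun q ↦ mfderiv 𝓘(ℝ, E') 𝓘(ℝ, E) ι q ((Y + Y') q)) =
          (fun q ↦ mfderiv 𝓘(ℝ, E') 𝓘(ℝ, E) ι q (Y q)) +
            fun q ↦ mfderiv 𝓘(ℝ, E') 𝓘(ℝ, E) ι q (Y' q) := by ext q; simp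
        rw [h2, h1]
        ext v
        simp
      leibniz := by
        intro Y g p hY hg _
        have h1 := pullbackCov_leibniz D
          (mdiffAlongAt_pushforward hι.isSmoothEmbedding.contMDiff hY) hg
        have h2 : (fun q ↦ mfderiv 𝓘(ℝ, E') 𝓘(ℝ, E) ι q ((g • Y) q)) =
          fun q ↦ g q • mfderiv 𝓘(ℝ, E') 𝓘(ℝ, E) ι q (Y q) := by ext q; simp
        rw [h2, h1]
        ext v
        simp [(exists_leftInverse hι.isSmoothEmbedding p).choose_spec] }

variable {EN : Type*} [NormedAddCommGroup EN] [NormedSpace ℝ EN] [FiniteDimensional ℝ EN]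
  {N : Type*} [TopologicalSpace N] [ChartedSpace EN N] [IsManifold 𝓘(ℝ, EN) ∞ N]

/-- `(D_v df)(w)`, where `D` is the connection on `T^*N ⊗ f^*TM` induced by the Levi-Civita
connection `∇` of `h` and by `D`: `(D_v df)(w) = (f^*D)_v (df W) - df (∇_v W)` for any vector field
`W` that is smooth near `x` with `W x = w`. -/
def covDerivDifferential (h : PseudoRiemannianMetric EN N)
    (D : CovariantDerivative 𝓘(ℝ, E) E (TangentSpace 𝓘(ℝ, E) : M → Type _)) (f : N → M)
    (x : N) (v w : TangentSpace 𝓘(ℝ, EN) x) : TangentSpace 𝓘(ℝ, E) (f x) :=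
  pullbackCov D f (fun y ↦ mfderiv 𝓘(ℝ, EN) 𝓘(ℝ, E) f y (extend EN w y)) x v
    - mfderiv 𝓘(ℝ, EN) 𝓘(ℝ, E) f x (h.leviCivita (extend EN w) x v)

/-- `e` is an orthonormal basis: `h(e_i, e_j) = 0` for `i ≠ j` and `ε_i = h(e_i, e_i) = ±1`. -/
structure PseudoRiemannianMetric.IsOrthonormal (h : PseudoRiemannianMetric EN N) {x : N} {n : ℕ}
    (e : Module.Basis (Fin n) ℝ (TangentSpace 𝓘(ℝ, EN) x)) : Prop where
  norm : ∀ i, h.inner x (e i) (e i) = 1 ∨ h.inner x (e i) (e i) = -1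
  orthogonal : ∀ i j, i ≠ j → h.inner x (e i) (e j) = 0

/-- The map `f` is harmonic: it is smooth and `tr D df = ∑ ε_i (D_{e_i} df)(e_i) = 0` for
orthonormal bases `e` of the tangent spaces. -/
structure IsHarmonic (h : PseudoRiemannianMetric EN N)
    (D : CovariantDerivative 𝓘(ℝ, E) E (TangentSpace 𝓘(ℝ, E) : M → Type _)) (f : N → M) :
    Prop where
  contMDiff : ContMDiff 𝓘(ℝ, EN) 𝓘(ℝ, E) ∞ f
  trace_eq_zero : ∀ (x : N) (n : ℕ) (e : Module.Basis (Fin n) ℝ (TangentSpace 𝓘(ℝ, EN) x)),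
    h.IsOrthonormal e →
      ∑ i, h.inner x (e i) (e i) • covDerivDifferential h D f x (e i) (e i) = 0

end Harmonic
end

/-! The point is that `ι` has vanishing second fundamental form: `dι` is parallel for `D'` and
`ι^*D`. Hence `dι` commutes with covariant differentiation along any map into `M'`, and since `d(ι ∘
φ) = dι ∘ dφ` this gives `D d(ι ∘ φ) = dι (D dφ)`. Tracing with `h` commutes with the linear map
`dι`, and `dι` is injective, so the two traces vanish together. Smoothness transfers because `ι` is
an immersion and a homeomorphism onto its image.

Total geodesy speaks only of globally defined smooth fields on `M`, so `exists_smooth_tangent_field`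
supplies enough of them. With these, `pullbackCov_pushforward_extend_mem_range` shows that
`(ι^*D)(dι Y)` stays in the range of `dι`, so the left inverse used to define `D'` loses nothing
(`mfderiv_inducedConnection_extend`). The chain rule `pullbackCov_comp_pushforward`, valid for any
smooth `ι`, then carries the identity from `M'` to fields along `φ`. Such a field need not be the
restriction of a field on `M'`, which is why this is computed in trivializations. -/

/-! ### The product rule for evaluating a family of linear maps. -/

theorem HasMFDerivAt.clm_apply {E₁ : Type*} [NormedAddCommGroup E₁] [NormedSpace ℝ E₁]
    {N : Type*} [TopologicalSpace N] [ChartedSpace E₁ N]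
    {F G : Type*} [NormedAddCommGroup F] [NormedSpace ℝ F] [NormedAddCommGroup G] [NormedSpace ℝ G]
    {A : N → F →L[ℝ] G} {c : N → F} {x : N} {A' : E₁ →L[ℝ] F →L[ℝ] G} {c' : E₁ →L[ℝ] F}
    (hA : HasMFDerivAt 𝓘(ℝ, E₁) 𝓘(ℝ, F →L[ℝ] G) A x A')
    (hc : HasMFDerivAt 𝓘(ℝ, E₁) 𝓘(ℝ, F) c x c') :
    HasMFDerivAt 𝓘(ℝ, E₁) 𝓘(ℝ, G) (fun y ↦ A y (c y)) x (A x ∘L c' + A'.flip (c x)) := by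
  refine ⟨hA.1.clm_apply hc.1, ?_⟩
  -- The targets are vector spaces, so by unfolding the manifold derivative is the ordinary
  -- derivative of the map read in the chart of the source.
  have hA₂ : HasFDerivWithinAt (A ∘ (extChartAt 𝓘(ℝ, E₁) x).symm) A' (Set.range 𝓘(ℝ, E₁))
    (extChartAt 𝓘(ℝ, E₁) x x) := hA.2
  have hc₂ : HasFDerivWithinAt (c ∘ (extChartAt 𝓘(ℝ, E₁) x).symm) c' (Set.range 𝓘(ℝ, E₁))
    (extChartAt 𝓘(ℝ, E₁) x x) := hc.2
  have := hA₂.clm_apply hc₂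
  simp only [Function.comp_apply, extChartAt_to_inv] at this
  exact this

theorem mvfderiv_clm_apply {E₁ : Type*} [NormedAddCommGroup E₁] [NormedSpace ℝ E₁]
    {N : Type*} [TopologicalSpace N] [ChartedSpace E₁ N]
    {F G : Type*} [NormedAddCommGroup F] [NormedSpace ℝ F] [NormedAddCommGroup G] [NormedSpace ℝ G]
    {A : N → F →L[ℝ] G} {c : N → F} {x : N}
    (hA : MDifferentiableAt 𝓘(ℝ, E₁) 𝓘(ℝ, F →L[ℝ] G) A x)
    (hc : MDifferentiableAt 𝓘(ℝ, E₁) 𝓘(ℝ, F) c x) (v : TangentSpace 𝓘(ℝ, E₁) x) :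
    mvfderiv 𝓘(ℝ, E₁) (fun y ↦ A y (c y)) x v =
      A x (mvfderiv 𝓘(ℝ, E₁) c x v) + mvfderiv 𝓘(ℝ, E₁) A x v (c x) := by
  have := (HasMFDerivAt.clm_apply hA.hasMFDerivAt hc.hasMFDerivAt).mfderiv
  exact congrArg (fun L ↦ L v) this

section

variable {E' : Type*} [NormedAddCommGroup E'] [NormedSpace ℝ E']
  {M' : Type*} [TopologicalSpace M'] [ChartedSpace E' M'] [IsManifold 𝓘(ℝ, E') ∞ M']
  {E : Type*} [NormedAddCommGroup E] [NormedSpace ℝ E]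
  {M : Type*} [TopologicalSpace M] [ChartedSpace E M] [IsManifold 𝓘(ℝ, E) ∞ M]

/-! ### Global tangent fields on the ambient manifold. -/

/-- Every tangent vector of an embedded submanifold is the value of a global smooth vector field on
the ambient manifold that is tangent to the submanifold, and that is near the given point the
push-forward of a field on the submanifold. -/
theorem exists_smooth_tangent_field [FiniteDimensional ℝ E] [FiniteDimensional ℝ E'] [T2Space M]
    {ι : M' → M}
    (hι : Manifold.IsSmoothEmbedding 𝓘(ℝ, E') 𝓘(ℝ, E) ∞ ι) (p : M')
    (u : TangentSpace 𝓘(ℝ, E') p) :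
    ∃ (X : Π y : M, TangentSpace 𝓘(ℝ, E) y) (Y : Π q : M', TangentSpace 𝓘(ℝ, E') q),
      CMDiff ∞ (T% X) ∧ IsTangentTo E' ι X ∧ MDiffAt (T% Y) p ∧ Y p = u ∧
      ∀ᶠ q in 𝓝 p, mfderiv 𝓘(ℝ, E') 𝓘(ℝ, E) ι q (Y q) = X (ι q) := by
  have : CompleteSpace E := FiniteDimensional.complete ℝ E
  have : CompleteSpace E' := FiniteDimensional.complete ℝ E'
  have H := hι.isImmersion.isImmersionAt p
  set c := H.codChart with hc
  set d := H.domChart with hd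
  have hcA := H.codChart_mem_maximalAtlas
  have hdA := H.domChart_mem_maximalAtlas
  have hcd : ∀ y ∈ c.source, ContMDiffAt 𝓘(ℝ, E) 𝓘(ℝ, E) ∞ c y :=
    fun y hy ↦ contMDiffAt_of_mem_maximalAtlas hcA hy
  have hdd : ∀ q ∈ d.source, ContMDiffAt 𝓘(ℝ, E') 𝓘(ℝ, E') ∞ d q :=
    fun y hy ↦ contMDiffAt_of_mem_maximalAtlas hdA hy
  have hcM : c.MDifferentiable 𝓘(ℝ, E) 𝓘(ℝ, E) :=
    ⟨fun y hy ↦ ((hcd y hy).mdifferentiableAt (by simp)).mdifferentiableWithinAt, fun y hy ↦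
      ((contMDiffAt_symm_of_mem_maximalAtlas hcA hy).mdifferentiableAt
        (by simp)).mdifferentiableWithinAt⟩
  have hdM : d.MDifferentiable 𝓘(ℝ, E') 𝓘(ℝ, E') :=
    ⟨fun y hy ↦ ((hdd y hy).mdifferentiableAt (by simp)).mdifferentiableWithinAt, fun y hy ↦
      ((contMDiffAt_symm_of_mem_maximalAtlas hdA hy).mdifferentiableAt
        (by simp)).mdifferentiableWithinAt⟩
  have hcI : ∀ y ∈ c.source, (mfderiv 𝓘(ℝ, E) 𝓘(ℝ, E) c y).IsInvertible :=
    fun y hy ↦ ⟨hcM.mfderiv hy, rfl⟩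
  have hdI : ∀ y ∈ d.source, (mfderiv 𝓘(ℝ, E') 𝓘(ℝ, E') d y).IsInvertible :=
    fun y hy ↦ ⟨hdM.mfderiv hy, rfl⟩
  -- In the slice charts `d` and `c` of the immersion, `ι` is this linear inclusion. Constant fields
  -- `u₀` and `j u₀` are therefore `ι`-related in charts, and so are their pullbacks `Y` and `V`.
  let j : E' →L[ℝ] E := H.equiv.toContinuousLinearMap ∘L ContinuousLinearMap.inl ℝ E' _
  have hsrc : ∀ q ∈ d.source, ι q ∈ c.source := H.source_subset_preimage_source
  have hloc : ∀ q ∈ d.source, c (ι q) = j (d q) := by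
    intro q hq
    have hq' : d q ∈ (d.extend 𝓘(ℝ, E')).target := by simp [hq]
    have := H.writtenInCharts hq'
    simpa [hq, ← hd, ← hc, j] using this
  have hder : ∀ q ∈ d.source, ∀ w : TangentSpace 𝓘(ℝ, E') q,
      mfderiv 𝓘(ℝ, E) 𝓘(ℝ, E) c (ι q) (mfderiv 𝓘(ℝ, E') 𝓘(ℝ, E) ι q w) =
        j (mfderiv 𝓘(ℝ, E') 𝓘(ℝ, E') d q w) := by
    intro q hq w
    have h1 := mfderiv_comp q ((hcd _ (hsrc q hq)).mdifferentiableAt (by simp))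
      (hι.contMDiff.contMDiffAt.mdifferentiableAt (x := q) (by simp))
    have h2 := mfderiv_comp q (I' := 𝓘(ℝ, E')) (g := j) (f := d) j.mdifferentiableAt
      ((hdd q hq).mdifferentiableAt (by simp))
    have h3 : c ∘ ι =ᶠ[𝓝 q] j ∘ d := by
      filter_upwards [d.open_source.mem_nhds hq] with z hz using hloc z hz
    rw [j.mfderiv_eq] at h2
    exact congrArg (fun L ↦ L w) (h1.symm.trans (h3.mfderiv_eq.trans h2))
  let u₀ : E' := mfderiv 𝓘(ℝ, E') 𝓘(ℝ, E') d p u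
  let V : Π y : M, TangentSpace 𝓘(ℝ, E) y :=
    mpullback 𝓘(ℝ, E) 𝓘(ℝ, E) c (fun _ ↦ j u₀)
  let Y : Π q : M', TangentSpace 𝓘(ℝ, E') q :=
    mpullback 𝓘(ℝ, E') 𝓘(ℝ, E') d (fun _ ↦ u₀)
  have hVY : ∀ q ∈ d.source, mfderiv 𝓘(ℝ, E') 𝓘(ℝ, E) ι q (Y q) = V (ι q) := by
    intro q hq
    apply (hcM.mfderiv (hsrc q hq)).injective
    refine (hder q hq (Y q)).trans ?_
    have e1 : mfderiv 𝓘(ℝ, E') 𝓘(ℝ, E') d q (Y q) = u₀ := (hdI q hq).self_apply_inverse _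
    have e2 : mfderiv 𝓘(ℝ, E) 𝓘(ℝ, E) c (ι q) (V (ι q)) = j u₀ :=
      (hcI _ (hsrc q hq)).self_apply_inverse _
    rw [e1]
    exact e2.symm
  -- This is where an injective immersion would not suffice: distant parts of `M'` could return
  -- close to `ι p`, where `V` need not be tangent to them. The subspace topology gives an open `U`
  -- that meets the image only in the slice `ι d.source`.
  obtain ⟨U, hU, hUd⟩ := hι.isEmbedding.isOpen_iff.1 d.open_source
  have hpU : ι p ∈ U := by
    have : p ∈ ι ⁻¹' U := hUd ▸ H.mem_domChart_source
    exact this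
  have hUc : U ∩ c.source ∈ 𝓝 (ι p) :=
    (hU.inter c.open_source).mem_nhds ⟨hpU, H.mem_codChart_source⟩
  -- The closed support has to lie in `c.source`, so that `b • V` is smooth on all of `M`, and in
  -- `U`, so that it is tangent to `M'` at every point of the image.
  obtain ⟨b, -, hb⟩ := (SmoothBumpFunction.nhds_basis_tsupport (I := 𝓘(ℝ, E)) (ι p)).mem_iff.1 hUc
  refine ⟨(b : M → ℝ) • V, Y, ?_, ?_, ?_, ?_, ?_⟩
  · refine ContMDiffOn.smul_section_of_tsupport (u := U ∩ c.source) b.contMDiff.contMDiffOn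
      (hU.inter c.open_source) hb fun y hy ↦ ContMDiffAt.contMDiffWithinAt ?_
    refine ContMDiffAt.mpullback_vectorField_preimage ?_ (hcd y hy.2) (hcI y hy.2) le_rfl
    exact (contMDiffAt_vectorSpace_iff_contDiffAt).2 contDiffAt_const
  · intro q
    by_cases hq : q ∈ d.source
    · exact ⟨b (ι q) • Y q, by simp [hVY q hq]⟩
    · refine ⟨0, ?_⟩
      have : ι q ∉ tsupport b := fun h ↦ hq (hUd ▸ (hb h).1)
      simp [image_eq_zero_of_notMem_tsupport this]
  · have : CMDiffAt 1 (T% Y) p := by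
      refine ContMDiffAt.mpullback_vectorField_preimage ?_ (hdd p H.mem_domChart_source)
        (hdI p H.mem_domChart_source) (n := ∞) (by norm_cast)
      exact (contMDiffAt_vectorSpace_iff_contDiffAt).2 contDiffAt_const
    exact this.mdifferentiableAt (by simp)
  · exact (hdI p H.mem_domChart_source).inverse_apply_self _
  · filter_upwards [d.open_source.mem_nhds H.mem_domChart_source,
      hι.contMDiff.continuous.continuousAt b.eventuallyEq_one] with q hq hq1
    have hq1 : b (ι q) = 1 := hq1
    simp [hVY q hq, hq1]

/-! ### Covariant derivatives of push-forwards along a map. -/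

variable {EN : Type*} [NormedAddCommGroup EN] [NormedSpace ℝ EN]
  {N : Type*} [TopologicalSpace N] [ChartedSpace EN N]

theorem pullbackCov_congr
    (D : CovariantDerivative 𝓘(ℝ, E) E (TangentSpace 𝓘(ℝ, E) : M → Type _)) {f : N → M}
    {s t : Π x : N, TangentSpace 𝓘(ℝ, E) (f x)} {x : N} (hst : ∀ᶠ y in 𝓝 x, s y = t y) :
    pullbackCov (E₁ := EN) D f s x = pullbackCov D f t x := by
  have h1 : fibreCoord f s x =ᶠ[𝓝 x] fibreCoord f t x := by
    filter_upwards [hst] with y hy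
    simp [fibreCoord, hy]
  have h2 : mvfderiv 𝓘(ℝ, EN) (fibreCoord f s x) x = mvfderiv 𝓘(ℝ, EN) (fibreCoord f t x) x := by
    ext v
    exact congrArg (fun L ↦ L v) (h1.mfderiv_eq (I := 𝓘(ℝ, EN)) (I' := 𝓘(ℝ, E)))
  rw [pullbackCov, pullbackCov, h2, hst.self_of_nhds]

/-- The covariant derivative along `ι ∘ φ` of the push-forward `dι s` of a vector field `s` along
`φ`: the covariant derivative of `dι` evaluated at `s`, plus `dι` of the coordinate derivative of
`s`. -/
theorem pullbackCov_comp_pushforward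
    (D : CovariantDerivative 𝓘(ℝ, E) E (TangentSpace 𝓘(ℝ, E) : M → Type _))
    {ι : M' → M} (hι : ContMDiff 𝓘(ℝ, E') 𝓘(ℝ, E) ∞ ι) {φ : N → M'}
    {s : Π x : N, TangentSpace 𝓘(ℝ, E') (φ x)} {x : N} (hs : MDiffAlongAt EN φ s x)
    (v : TangentSpace 𝓘(ℝ, EN) x) :
    pullbackCov D (ι ∘ φ) (fun y ↦ mfderiv 𝓘(ℝ, E') 𝓘(ℝ, E) ι (φ y) (s y)) x v =
      pullbackCov D ι (fun q ↦ mfderiv 𝓘(ℝ, E') 𝓘(ℝ, E) ι q (extend E' (s x) q)) (φ x)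
          (mfderiv 𝓘(ℝ, EN) 𝓘(ℝ, E') φ x v)
        + mfderiv 𝓘(ℝ, E') 𝓘(ℝ, E) ι (φ x)
          ((trivializationAt E' (TangentSpace 𝓘(ℝ, E') : M' → Type _) (φ x)).symmL ℝ (φ x)
            (mvfderiv 𝓘(ℝ, EN) (fibreCoord φ s x) x v)) := by
  set e := trivializationAt E' (TangentSpace 𝓘(ℝ, E') : M' → Type _) (φ x) with he
  set e₂ := trivializationAt E (TangentSpace 𝓘(ℝ, E) : M → Type _) (ι (φ x)) with he₂
  have hφ : MDifferentiableAt 𝓘(ℝ, EN) 𝓘(ℝ, E') φ x := ((mdifferentiableAt_totalSpace _ _).1 hs).1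
  have hιd : MDifferentiableAt 𝓘(ℝ, E') 𝓘(ℝ, E) ι (φ x) :=
    hι.contMDiffAt.mdifferentiableAt (by simp)
  have hφe : e.baseSet ∈ 𝓝 (φ x) := e.open_baseSet.mem_nhds (mem_baseSet_trivializationAt' _)
  have hmem : φ x ∈ e.baseSet := mem_baseSet_trivializationAt' _
  have hmem₂ : ι (φ x) ∈ e₂.baseSet := mem_baseSet_trivializationAt' _
  -- The matrix of `dι` in the two trivializations. In coordinates `dι s` is `A ∘ φ` applied to the
  -- coordinates `c` of `s`; the product rule separates the derivative of `A`, which becomes the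
  -- covariant derivative of `dι`, from that of `c`.
  let A : M' → E' →L[ℝ] E := fun q ↦
    e₂.continuousLinearMapAt ℝ (ι q) ∘L mfderiv 𝓘(ℝ, E') 𝓘(ℝ, E) ι q ∘L e.symmL ℝ q
  have hA : MDifferentiableAt 𝓘(ℝ, E') 𝓘(ℝ, E' →L[ℝ] E) A (φ x) :=
    ((hι.contMDiffAt (x := φ x)).mfderiv_const (m := 1) (by norm_cast)).mdifferentiableAt (by simp)
  let c : N → E' := fibreCoord φ s x
  have hc : MDifferentiableAt 𝓘(ℝ, EN) 𝓘(ℝ, E') c x := mdifferentiableAt_fibreCoord hs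
  have h1 : fibreCoord (ι ∘ φ) (fun y ↦ mfderiv 𝓘(ℝ, E') 𝓘(ℝ, E) ι (φ y) (s y)) x
      =ᶠ[𝓝 x] fun y ↦ (A ∘ φ) y (c y) := by
    filter_upwards [hφ.continuousAt hφe] with y hy
    have : e.symmL ℝ (φ y) (c y) = s y := e.symmL_continuousLinearMapAt hy (s y)
    simp only [A, Function.comp_apply, ContinuousLinearMap.comp_apply, this]
    rfl
  -- `extend` is constant in the trivialization near `φ x`, so only `A` gets differentiated here.
  have h2 : fibreCoord ι (fun q ↦ mfderiv 𝓘(ℝ, E') 𝓘(ℝ, E) ι q (extend E' (s x) q)) (φ x)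
      =ᶠ[𝓝 (φ x)] fun q ↦ A q (c x) := by
    filter_upwards [extend_eventuallyEq (φ x) (s x)] with q hq
    simp only [fibreCoord, hq]
    rfl
  have h1' : mvfderiv 𝓘(ℝ, EN) (fibreCoord (ι ∘ φ)
      (fun y ↦ mfderiv 𝓘(ℝ, E') 𝓘(ℝ, E) ι (φ y) (s y)) x) x v =
      A (φ x) (mvfderiv 𝓘(ℝ, EN) c x v) +
        mvfderiv 𝓘(ℝ, E') A (φ x) (mfderiv 𝓘(ℝ, EN) 𝓘(ℝ, E') φ x v) (c x) := by
    have e1 := congrArg (fun L ↦ L v) (h1.mfderiv_eq (I := 𝓘(ℝ, EN)) (I' := 𝓘(ℝ, E)))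
    have e2 := mvfderiv_clm_apply (hA.comp x hφ) hc v
    have e3 := congrArg (fun L ↦ L v) (mfderiv_comp x hA hφ)
    refine e1.trans (e2.trans ?_)
    congr 1
    exact congrArg (fun L : E' →L[ℝ] E ↦ L (c x)) e3
  have h2' (w : TangentSpace 𝓘(ℝ, E') (φ x)) : mvfderiv 𝓘(ℝ, E') (fibreCoord ι
      (fun q ↦ mfderiv 𝓘(ℝ, E') 𝓘(ℝ, E) ι q (extend E' (s x) q)) (φ x)) (φ x) w =
      mvfderiv 𝓘(ℝ, E') A (φ x) w (c x) := by
    have e1 := congrArg (fun L ↦ L w) (h2.mfderiv_eq (I := 𝓘(ℝ, E')) (I' := 𝓘(ℝ, E)))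
    have e2 := mvfderiv_clm_apply hA (c := fun _ ↦ c x) mdifferentiableAt_const w
    refine e1.trans (e2.trans ?_)
    simp [mvfderiv, mfderiv_const]
  have h3 (u : E') : e₂.symmL ℝ (ι (φ x)) (A (φ x) u) =
      mfderiv 𝓘(ℝ, E') 𝓘(ℝ, E) ι (φ x) (e.symmL ℝ (φ x) u) :=
    e₂.symmL_continuousLinearMapAt hmem₂ _
  have h4 : mfderiv 𝓘(ℝ, EN) 𝓘(ℝ, E) (ι ∘ φ) x v =
      mfderiv 𝓘(ℝ, E') 𝓘(ℝ, E) ι (φ x) (mfderiv 𝓘(ℝ, EN) 𝓘(ℝ, E') φ x v) :=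
    congrArg (fun L ↦ L v) (mfderiv_comp x hιd hφ)
  have L : pullbackCov D (ι ∘ φ) (fun y ↦ mfderiv 𝓘(ℝ, E') 𝓘(ℝ, E) ι (φ y) (s y)) x v =
      e₂.symmL ℝ (ι (φ x)) (mvfderiv 𝓘(ℝ, EN) (fibreCoord (ι ∘ φ)
        (fun y ↦ mfderiv 𝓘(ℝ, E') 𝓘(ℝ, E) ι (φ y) (s y)) x) x v) +
      D (extend E (mfderiv 𝓘(ℝ, E') 𝓘(ℝ, E) ι (φ x) (s x))) (ι (φ x))
        (mfderiv 𝓘(ℝ, EN) 𝓘(ℝ, E) (ι ∘ φ) x v) := rfl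
  have R (w : TangentSpace 𝓘(ℝ, E') (φ x)) :
      pullbackCov D ι (fun q ↦ mfderiv 𝓘(ℝ, E') 𝓘(ℝ, E) ι q (extend E' (s x) q)) (φ x) w =
      e₂.symmL ℝ (ι (φ x)) (mvfderiv 𝓘(ℝ, E') A (φ x) w (c x)) +
      D (extend E (mfderiv 𝓘(ℝ, E') 𝓘(ℝ, E) ι (φ x) (s x))) (ι (φ x))
        (mfderiv 𝓘(ℝ, E') 𝓘(ℝ, E) ι (φ x) w) := by
    rw [← h2' w, pullbackCov, extend_apply_self]
    rfl
  rw [L, R, h1', h4, map_add, h3]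
  abel

/-! ### Total geodesy makes `dι` parallel. -/

/-- Total geodesy enters the argument here. It controls `D_Z X` for global tangent fields `Z`, `X`
with values `dι v`, `dι u` at `ι p`; replacing the field on `M'` that corresponds to `X` by another
one with value `u` changes the derivative only by a vector in the range of `dι`. -/
theorem pullbackCov_pushforward_extend_mem_range [FiniteDimensional ℝ E] [FiniteDimensional ℝ E']
    [T2Space M] {D : CovariantDerivative 𝓘(ℝ, E) E (TangentSpace 𝓘(ℝ, E) : M → Type _)}
    {ι : M' → M} (hι : IsTotallyGeodesicEmbedding E' D ι) {p : M'}
    (u v : TangentSpace 𝓘(ℝ, E') p) :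
    pullbackCov D ι (fun q ↦ mfderiv 𝓘(ℝ, E') 𝓘(ℝ, E) ι q (extend E' u q)) p v ∈
      (mfderiv 𝓘(ℝ, E') 𝓘(ℝ, E) ι p).range := by
  have hs := hι.isSmoothEmbedding.contMDiff
  obtain ⟨Z, Z', hZ, hZt, -, hZp, hZZ⟩ := exists_smooth_tangent_field hι.isSmoothEmbedding p v
  obtain ⟨X, Y, hX, hXt, hY, hYp, hYX⟩ := exists_smooth_tangent_field hι.isSmoothEmbedding p u
  -- With the identity as `φ`, this formula compares `Y` with the `extend` of its value at `p`; the
  -- extra term is visibly in the range of `dι`.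
  have h1 := pullbackCov_comp_pushforward D hs (φ := fun q : M' ↦ q) (s := Y) (x := p) hY v
  have hid : mfderiv 𝓘(ℝ, E') 𝓘(ℝ, E') (fun q : M' ↦ q) p v = v :=
    congrArg (fun L ↦ L v) (mfderiv_id (I := 𝓘(ℝ, E')) (x := p))
  rw [hid, hYp] at h1
  have h2 : pullbackCov D ι (fun q ↦ mfderiv 𝓘(ℝ, E') 𝓘(ℝ, E) ι q (Y q)) p v =
      D X (ι p) (Z (ι p)) := by
    -- Near `p` the push-forward of `Y` is the restriction of `X`, so its derivative along `ι` is
    -- that of `X` in the direction `dι v = Z (ι p)`.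
    rw [pullbackCov_congr D hYX, pullbackCov_comp D (hs.contMDiffAt.mdifferentiableAt (by simp))
      (hX.contMDiffAt.mdifferentiableAt (by simp)), ← hZZ.self_of_nhds, hZp]
    rfl
  have h3 : D X (ι p) (Z (ι p)) ∈ (mfderiv 𝓘(ℝ, E') 𝓘(ℝ, E) ι p).range :=
    hι.tangent Z X hZ hX hZt hXt p
  rw [h2.symm.trans h1] at h3
  refine (Submodule.add_mem_iff_left (mfderiv 𝓘(ℝ, E') 𝓘(ℝ, E) ι p).range ?_).1 h3
  exact LinearMap.mem_range_self _ _

/-- The defining property `dι (D'_v Y) = (ι^*D)_v (dι Y)` of the induced connection, for fields `Y`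
extended constantly in the trivialization. -/
theorem mfderiv_inducedConnection_extend [FiniteDimensional ℝ E] [FiniteDimensional ℝ E']
    [T2Space M] {D : CovariantDerivative 𝓘(ℝ, E) E (TangentSpace 𝓘(ℝ, E) : M → Type _)}
    {ι : M' → M} (hι : IsTotallyGeodesicEmbedding E' D ι) {p : M'}
    (u v : TangentSpace 𝓘(ℝ, E') p) :
    mfderiv 𝓘(ℝ, E') 𝓘(ℝ, E) ι p (inducedConnection D ι hι (extend E' u) p v) =
      pullbackCov D ι (fun q ↦ mfderiv 𝓘(ℝ, E') 𝓘(ℝ, E) ι q (extend E' u q)) p v := by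
  obtain ⟨w, hw⟩ := pullbackCov_pushforward_extend_mem_range hι u v
  have h1 : inducedConnection D ι hι (extend E' u) p v =
    (exists_leftInverse hι.isSmoothEmbedding p).choose
      (pullbackCov D ι (fun q ↦ mfderiv 𝓘(ℝ, E') 𝓘(ℝ, E) ι q (extend E' u q)) p v) := rfl
  have h2 := (exists_leftInverse hι.isSmoothEmbedding p).choose_spec w
  rw [h1, ← hw]
  exact congrArg _ h2

/-- The covariant derivative of `dι` in the general formula is now `dι` of the connection term of
`D'`; together with the coordinate derivative of `s` it is, by definition, the pull-back of `D'`
along `φ`. -/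
theorem pullbackCov_comp_pushforward_of_isTotallyGeodesicEmbedding
    [FiniteDimensional ℝ E] [FiniteDimensional ℝ E']
    [T2Space M] {D : CovariantDerivative 𝓘(ℝ, E) E (TangentSpace 𝓘(ℝ, E) : M → Type _)}
    {ι : M' → M} (hι : IsTotallyGeodesicEmbedding E' D ι) {φ : N → M'}
    {s : Π x : N, TangentSpace 𝓘(ℝ, E') (φ x)} {x : N} (hs : MDiffAlongAt EN φ s x)
    (v : TangentSpace 𝓘(ℝ, EN) x) :
    pullbackCov D (ι ∘ φ) (fun y ↦ mfderiv 𝓘(ℝ, E') 𝓘(ℝ, E) ι (φ y) (s y)) x v =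
      mfderiv 𝓘(ℝ, E') 𝓘(ℝ, E) ι (φ x) (pullbackCov (inducedConnection D ι hι) φ s x v) := by
  rw [pullbackCov_comp_pushforward D hι.isSmoothEmbedding.contMDiff hs,
    ← mfderiv_inducedConnection_extend hι, ← map_add, add_comm]
  rfl

/-- The field along `φ` to differentiate is `dφ W`, with `W` the extension of `w`. The Levi-Civita
term involves only first derivatives of the maps, so the chain rule suffices for it. -/
theorem covDerivDifferential_comp_of_isTotallyGeodesicEmbedding
    [FiniteDimensional ℝ E] [FiniteDimensional ℝ E'] [FiniteDimensional ℝ EN]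
    [IsManifold 𝓘(ℝ, EN) ∞ N]
    [T2Space M] {D : CovariantDerivative 𝓘(ℝ, E) E (TangentSpace 𝓘(ℝ, E) : M → Type _)}
    (h : PseudoRiemannianMetric EN N)
    {ι : M' → M} (hι : IsTotallyGeodesicEmbedding E' D ι) {φ : N → M'}
    (hφ : ContMDiff 𝓘(ℝ, EN) 𝓘(ℝ, E') ∞ φ) (x : N) (v w : TangentSpace 𝓘(ℝ, EN) x) :
    covDerivDifferential h D (ι ∘ φ) x v w =
      mfderiv 𝓘(ℝ, E') 𝓘(ℝ, E) ι (φ x)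
        (covDerivDifferential h (inducedConnection D ι hι) φ x v w) := by
  have hcomp (y : N) (u : TangentSpace 𝓘(ℝ, EN) y) : mfderiv 𝓘(ℝ, EN) 𝓘(ℝ, E) (ι ∘ φ) y u =
      mfderiv 𝓘(ℝ, E') 𝓘(ℝ, E) ι (φ y) (mfderiv 𝓘(ℝ, EN) 𝓘(ℝ, E') φ y u) :=
    congrArg (fun L ↦ L u) (mfderiv_comp y
      (hι.isSmoothEmbedding.contMDiff.contMDiffAt.mdifferentiableAt (by simp))
      (hφ.contMDiffAt.mdifferentiableAt (by simp)))
  have h1 : MDiffAlongAt EN φ (fun y ↦ mfderiv 𝓘(ℝ, EN) 𝓘(ℝ, E') φ y (extend EN w y)) x :=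
    mdiffAlongAt_pushforward hφ (mdifferentiableAt_extend 𝓘(ℝ, EN) EN w)
  rw [covDerivDifferential, covDerivDifferential, map_sub,
    ← pullbackCov_comp_pushforward_of_isTotallyGeodesicEmbedding hι h1, hcomp]
  simp only [hcomp]

end

/-! ### Equivalence of harmonicity. -/

theorem mainTheorem7
    {E' : Type*} [NormedAddCommGroup E'] [NormedSpace ℝ E'] [FiniteDimensional ℝ E']
    {M' : Type*} [TopologicalSpace M'] [T2Space M'] [ChartedSpace E' M']
    [IsManifold 𝓘(ℝ, E') ∞ M']
    {E : Type*} [NormedAddCommGroup E] [NormedSpace ℝ E] [FiniteDimensional ℝ E]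
    {M : Type*} [TopologicalSpace M] [T2Space M] [ChartedSpace E M] [IsManifold 𝓘(ℝ, E) ∞ M]
    {EN : Type*} [NormedAddCommGroup EN] [NormedSpace ℝ EN] [FiniteDimensional ℝ EN]
    {N : Type*} [TopologicalSpace N] [T2Space N] [ChartedSpace EN N] [IsManifold 𝓘(ℝ, EN) ∞ N]
    (D : CovariantDerivative 𝓘(ℝ, E) E (TangentSpace 𝓘(ℝ, E) : M → Type _))
    [CovariantDerivative.ContMDiffCovariantDerivative D ∞]
    (h : PseudoRiemannianMetric EN N)
    (ι : M' → M) (hι : IsTotallyGeodesicEmbedding E' D ι) (φ : N → M') :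
    IsHarmonic h (inducedConnection D ι hι) φ ↔ IsHarmonic h D (ι ∘ φ) := by
  have hsmooth : ContMDiff 𝓘(ℝ, EN) 𝓘(ℝ, E') ∞ φ ↔ ContMDiff 𝓘(ℝ, EN) 𝓘(ℝ, E) ∞ (ι ∘ φ) := by
    -- Lifting smoothness through an immersion requires continuity of `φ`, which the topological
    -- embedding provides from that of `ι ∘ φ`.
    rw [ContMDiff.iff_comp_isImmersion hι.isSmoothEmbedding.isImmersion,
      hι.isSmoothEmbedding.isEmbedding.continuous_iff, and_iff_right_of_imp]
    exact fun hc ↦ hc.continuous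
  have htrace (hφ : ContMDiff 𝓘(ℝ, EN) 𝓘(ℝ, E') ∞ φ) (x : N) (n : ℕ)
      (e : Module.Basis (Fin n) ℝ (TangentSpace 𝓘(ℝ, EN) x)) :
      ∑ i, h.inner x (e i) (e i) • covDerivDifferential h D (ι ∘ φ) x (e i) (e i) =
        mfderiv 𝓘(ℝ, E') 𝓘(ℝ, E) ι (φ x) (∑ i, h.inner x (e i) (e i) •
          covDerivDifferential h (inducedConnection D ι hι) φ x (e i) (e i)) := by
    simp only [map_sum, map_smul,
      covDerivDifferential_comp_of_isTotallyGeodesicEmbedding h hι hφ]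
  constructor
  · intro H
    refine ⟨hsmooth.1 H.contMDiff, fun x n e he ↦ ?_⟩
    rw [htrace H.contMDiff, H.trace_eq_zero x n e he]
    exact map_zero _
  · intro H
    have hφ := hsmooth.2 H.contMDiff
    refine ⟨hφ, fun x n e he ↦ ?_⟩
    have h1 := H.trace_eq_zero x n e he
    rw [htrace hφ] at h1
    exact mfderiv_injective_of_isImmersion hι.isSmoothEmbedding.isImmersion (φ x)
      (h1.trans (map_zero _).symm)
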